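/- **Gabriel–Ulmer duality.** Let $\mathbf{Set}$ be the category of small sets. Let $\mathbf{LEX}$ be the 2-category of (possibly large) categories with finite limits, functors preserving finite limits, and natural transformations; let $\mathbf{LFC}$ be the 2-category of (possibly large) categories with small limits and small filtered colimits, functors preserving both, and natural transformations. Let $\mathbf{Lex}\subseteq\mathbf{LEX}$ and $\mathbf{LFP}\subseteq\mathbf{LFC}$ be the full sub-2-categories on the essentially small categories and on the locally finitely presentable categories, respectively. (A category is locally finitely presentable if it is locally small and cocomplete and has an essentially small class of finitely presentable objects such that every object is a small filtered colimit of objects of that class; an object $X$ is finitely presentable if $\mathrm{Hom}(X,-)$ preserves small filtered colimits.) The 2-functors $G=\mathbf{LEX}(-,\mathbf{Set}):\mathbf{LEX}^{\mathrm{op}}\to\mathbf{LFC}$ and $F=\mathbf{LFC}(-,\mathbf{Set}):\mathbf{LFC}\to\mathbf{LEX}^{\mathrm{op}}$ form a 2-adjunction $F\dashv G$ whose counit $\varepsilon_{\mathbb C}:\mathbb C\to\mathbf{LFC}(\mathbf{LEX}(\mathbb C,\mathbf{Set}),\mathbf{Set})$, $c\mapsto(M\mapsto M(c))$, and unit $\eta_{\mathcal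 A}:\mathcal A\to\mathbf{LEX}(\mathbf{LFC}(\mathcal A,\mathbf{Set}),\mathbf{Set})$, $a\mapsto(X\mapsto X(a))$, are given by evaluation. This 2-adjunction restricts to an equivalence of 2-categories between $\mathbf{Lex}^{\mathrm{op}}$ and $\mathbf{LFP}$; that is, $F$ and $G$ restrict to 2-functors between them, and all components of the restricted unit and counit are equivalences. Concretely: (i) For every essentially small category $\mathbb C$ with finite limits, $\mathbf{LEX}(\mathbb C,\mathbf{Set})$ is locally finitely presentable and $\varepsilon_{\mathbb C}$ is an equivalence of categories. (ii) Every locally finitely presentable category $\mathcal A$ has small limits and small filtered colimits, $\mathbf{LFC}(\mathcal A,\mathbf{Set})$ is essentially small and has finite limits, and $\eta_{\mathcal A}$ is an equivalence of categories. Moreover, if $\mathcal A_{fp}$ denotes the full subcategory of finitely presentable objects, the functors $\mathcal A_{fp}^{\mathrm{op}}\to\mathbf{LFC}(\mathcal A,\mathbf{Set})$, $X\mapsto\mathcal A(X,-)$, and $\mathcal A\to\mathbf{LEX}(\mathcal A_{fp}^{\mathrm{op}},\mathbf{Set})$, $a\mapsto\mathcal A(-,a)$, are equivalences of categories. -/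

import Mathlib

open CategoryTheory Limits Bicategory Opposite

universe w u v w₁ w₂ v₁ v₂ v₃ u₁ u₂ u₃

namespace GabrielUlmer

section FunctorCategories

variable (A : Type u₁) [Category.{v₁} A] (B : Type u₂) [Category.{v₂} B]

/-- The property of a functor to preserve `w`-small limits and `w`-small filtered colimits. -/
def lfcFunctor : ObjectProperty (A ⥤ B) := fun F =>
  PreservesLimitsOfSize.{w, w} F ∧ PreservesFilteredColimitsOfSize.{w, w} F

/-- Functors preserving `w`-small limits and `w`-small filtered colimits, with all natural
transformations between them. -/
abbrev LFCFunctor := (lfcFunctor.{w} A B).FullSubcategory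

end FunctorCategories

section Closure

variable {C : Type u₁} [Category.{v₁} C]

lemma preservesLimitsOfShape_closed (K : Type u₂) [Category.{v₂} K] (J : Type u₃) [Category.{v₃} J]
    [HasLimitsOfShape J (Type w)] {G : C ⥤ Type w}
    (p : LimitPresentation J G)
    (h : ∀ j, PreservesLimitsOfShape K (p.diag.obj j)) : PreservesLimitsOfShape K G := by
  have : PreservesLimitsOfShape K p.diag.flip := ⟨fun {F} ↦ ⟨fun {c} hc ↦
      ⟨evaluationJointlyReflectsLimits _
        (fun k' ↦ isLimitOfPreserves (p.diag.obj k') hc)⟩⟩⟩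
  have : PreservesLimitsOfShape K (lim : (J ⥤ Type w) ⥤ Type w) := inferInstance
  let e : p.diag.flip ⋙ lim ≅ G :=
    NatIso.ofComponents
      (fun j ↦ (limit.isLimit (p.diag.flip.obj j)).conePointUniqueUpToIso
        (isLimitOfPreserves ((evaluation _ _).obj j) p.isLimit)) (by
        intro X Y f
        have fac : ∀ (Z : C) (j : J),
            (isLimitOfPreserves ((evaluation C (Type w)).obj Z) p.isLimit).lift
              (limit.cone (p.diag.flip.obj Z)) ≫ (p.π.app j).app Z =
            limit.π (p.diag.flip.obj Z) j :=
          fun Z j => (isLimitOfPreserves ((evaluation C (Type w)).obj Z) p.isLimit).fac _ j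
        apply (isLimitOfPreserves ((evaluation _ _).obj Y) p.isLimit).hom_ext
        intro j
        have h₁ := fac X j
        have h₂ := fac Y j
        simp [IsLimit.conePointUniqueUpToIso]
        rw [h₂, reassoc_of% h₁]
        simp)
  exact preservesLimitsOfShape_of_natIso e

instance leftExact_closedUnderLimits (J : Type w) [SmallCategory J] :
    (leftExactFunctor C (Type w)).IsClosedUnderLimitsOfShape J where
  limitsOfShape_le := by
    rintro F ⟨p⟩
    exact ⟨fun K _ _ => preservesLimitsOfShape_closed K J p.toLimitPresentation
      fun j => (p.prop_diag_obj j).preservesFiniteLimits K⟩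

instance leftExact_closedUnderFilteredColimits (J : Type w) [SmallCategory J] [IsFiltered J] :
    (leftExactFunctor C (Type w)).IsClosedUnderColimitsOfShape J :=
  have : HasExactColimitsOfShape J (Type w) := ⟨inferInstance⟩
  inferInstanceAs ((ObjectProperty.preservesFiniteLimits :
    ObjectProperty (C ⥤ Type w)).IsClosedUnderColimitsOfShape J)

instance lfc_closedUnderFiniteLimits (J : Type) [SmallCategory J] [FinCategory J] :
    (lfcFunctor.{w} C (Type w)).IsClosedUnderLimitsOfShape J where
  limitsOfShape_le := by
    rintro F ⟨p⟩
    have h := p.prop_diag_obj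
    refine ⟨⟨fun {K} _ => preservesLimitsOfShape_closed.{w} (G := F) K J p.toLimitPresentation
      fun j => (h j).1.preservesLimitsOfShape⟩, ?_⟩
    have := Cardinal.fact_isRegular_aleph0.{w}
    have h' : ∀ j, (p.diag.obj j).IsCardinalAccessible Cardinal.aleph0.{w} := fun j =>
      Functor.IsFinitelyAccessible_iff_preservesFilteredColimitsOfSize.2 (h j).2
    exact Functor.IsFinitelyAccessible_iff_preservesFilteredColimitsOfSize.1
      (Functor.isCardinalAccessible_of_isLimit p.cone p.isLimit Cardinal.aleph0.{w}
        ((hasCardinalLT_aleph0_iff _).2 inferInstance))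

instance leftExact_hasLimits : HasLimitsOfSize.{w, w} (C ⥤ₗ Type w) := ⟨fun _ _ => inferInstance⟩

instance leftExact_hasFilteredColimits : HasFilteredColimitsOfSize.{w, w} (C ⥤ₗ Type w) :=
  ⟨fun _ _ _ => inferInstance⟩

instance lfc_hasFiniteLimits : HasFiniteLimits (LFCFunctor.{w} C (Type w)) :=
  ⟨fun _ _ _ => inferInstance⟩

end Closure

section Evaluation

variable (C : Type u₁) [Category.{v₁} C]

/-- Evaluation at `c`, as a functor `LEX(C, Set) ⥤ Set` preserving small limits and
small filtered colimits. -/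
def lexEvaluation (c : C) : LFCFunctor.{w} (C ⥤ₗ Type w) (Type w) :=
  ⟨LeftExactFunctor.forget C (Type w) ⋙ (evaluation C (Type w)).obj c,
    ⟨⟨fun {_} _ => inferInstance⟩, ⟨fun _ _ _ => inferInstance⟩⟩⟩

/-- Evaluation at `a`, as a left exact functor `LFC(A, Set) ⥤ Set`. -/
def lfcEvaluation (a : C) : LFCFunctor.{w} C (Type w) ⥤ₗ Type w :=
  ⟨(lfcFunctor.{w} C (Type w)).ι ⋙ (evaluation C (Type w)).obj a, ⟨fun _ _ _ => inferInstance⟩⟩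

/-- The evaluation functor `C ⥤ LFC(LEX(C, Set), Set)`, `c ↦ (M ↦ M c)`. -/
def lexEv : C ⥤ LFCFunctor.{w} (C ⥤ₗ Type w) (Type w) where
  obj c := lexEvaluation C c
  map f := ObjectProperty.homMk
    (Functor.whiskerLeft (LeftExactFunctor.forget C (Type w)) ((evaluation C (Type w)).map f))

/-- The evaluation functor `A ⥤ LEX(LFC(A, Set), Set)`, `a ↦ (X ↦ X a)`. -/
def lfcEv : C ⥤ (LFCFunctor.{w} C (Type w) ⥤ₗ Type w) where
  obj a := lfcEvaluation C a
  map f := ObjectProperty.homMk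
    (Functor.whiskerLeft (lfcFunctor.{w} C (Type w)).ι ((evaluation C (Type w)).map f))

end Evaluation

section Precomposition

variable {C : Type u₁} [Category.{v₁} C] {D : Type u₂} [Category.{v₂} D]

lemma preservesLimitsOfShape_lift {E : Type u₃} [Category.{v₃} E] (P : ObjectProperty D)
    (F : E ⥤ P.FullSubcategory) (J : Type u₁) [Category.{v₁} J]
    [PreservesLimitsOfShape J (F ⋙ P.ι)] : PreservesLimitsOfShape J F :=
  preservesLimitsOfShape_of_reflects_of_preserves F P.ι

lemma preservesColimitsOfShape_lift {E : Type u₃} [Category.{v₃} E] (P : ObjectProperty D)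
    (F : E ⥤ P.FullSubcategory) (J : Type u₁) [Category.{v₁} J]
    [PreservesColimitsOfShape J (F ⋙ P.ι)] : PreservesColimitsOfShape J F :=
  preservesColimitsOfShape_of_reflects_of_preserves F P.ι

/-- Precomposition with a left exact functor `φ`, as a functor `LEX(D, Set) ⥤ LEX(C, Set)`. -/
def lexPrecompFunctor (φ : C ⥤ₗ D) : (D ⥤ₗ Type w) ⥤ (C ⥤ₗ Type w) where
  obj M := ⟨φ.obj ⋙ M.obj, comp_preservesFiniteLimits _ _⟩
  map α := ObjectProperty.homMk (Functor.whiskerLeft φ.obj α.hom)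

/-- Precomposition with a left exact functor preserves small limits and small filtered
colimits. -/
def lexPrecomp (φ : C ⥤ₗ D) : LFCFunctor.{w} (D ⥤ₗ Type w) (C ⥤ₗ Type w) :=
  ⟨lexPrecompFunctor φ, ⟨fun {J} _ =>
      have : PreservesLimitsOfShape J (lexPrecompFunctor.{w} φ ⋙
          (leftExactFunctor C (Type w)).ι) :=
        inferInstanceAs (PreservesLimitsOfShape J ((leftExactFunctor D (Type w)).ι ⋙
          (Functor.whiskeringLeft C D (Type w)).obj φ.obj))
      preservesLimitsOfShape_lift _ _ _⟩,
    ⟨fun J _ _ =>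
      have : PreservesColimitsOfShape J (lexPrecompFunctor.{w} φ ⋙
          (leftExactFunctor C (Type w)).ι) :=
        inferInstanceAs (PreservesColimitsOfShape J ((leftExactFunctor D (Type w)).ι ⋙
          (Functor.whiskeringLeft C D (Type w)).obj φ.obj))
      preservesColimitsOfShape_lift _ _ _⟩⟩

lemma lfcFunctor_comp {E : Type u₃} [Category.{v₃} E] {F : C ⥤ D} {G : D ⥤ E}
    (hF : lfcFunctor.{w} C D F) (hG : lfcFunctor.{w} D E G) : lfcFunctor.{w} C E (F ⋙ G) :=
  have := hF.1
  have := hF.2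
  have := hG.1
  have := hG.2
  ⟨inferInstance, inferInstance⟩

/-- Precomposition with `φ` in `LFC`, as a functor `LFC(D, Set) ⥤ LFC(C, Set)`. -/
def lfcPrecompFunctor (φ : LFCFunctor.{w} C D) :
    LFCFunctor.{w} D (Type w) ⥤ LFCFunctor.{w} C (Type w) where
  obj X := ⟨φ.obj ⋙ X.obj, lfcFunctor_comp φ.property X.property⟩
  map α := ObjectProperty.homMk (Functor.whiskerLeft φ.obj α.hom)

/-- Precomposition with a 1-cell of `LFC` is left exact. -/
def lfcPrecomp (φ : LFCFunctor.{w} C D) :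
    LFCFunctor.{w} D (Type w) ⥤ₗ LFCFunctor.{w} C (Type w) :=
  ⟨lfcPrecompFunctor φ, ⟨fun J _ _ =>
      have : PreservesLimitsOfShape J (lfcPrecompFunctor.{w} φ ⋙
          (lfcFunctor.{w} C (Type w)).ι) :=
        inferInstanceAs (PreservesLimitsOfShape J ((lfcFunctor.{w} D (Type w)).ι ⋙
          (Functor.whiskeringLeft C D (Type w)).obj φ.obj))
      preservesLimitsOfShape_lift _ _ _⟩⟩

lemma lexEv_leftExact : leftExactFunctor C _ (lexEv.{w} C) :=
  ⟨fun J _ _ =>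
    have : PreservesLimitsOfShape J (lexEv.{w} C ⋙ (lfcFunctor.{w} (C ⥤ₗ Type w) (Type w)).ι) :=
      preservesLimitsOfShape_of_evaluation _ _
        fun M => inferInstanceAs (PreservesLimitsOfShape J M.obj)
    preservesLimitsOfShape_lift _ _ _⟩

lemma lfcEv_lfc : lfcFunctor.{w} C _ (lfcEv.{w} C) :=
  ⟨⟨fun {J} _ =>
    have : PreservesLimitsOfShape J (lfcEv.{w} C ⋙
        (leftExactFunctor (LFCFunctor.{w} C (Type w)) (Type w)).ι) :=
      preservesLimitsOfShape_of_evaluation _ _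
        fun X => X.property.1.preservesLimitsOfShape
    preservesLimitsOfShape_lift _ _ _⟩,
  ⟨fun J _ _ =>
    have : PreservesColimitsOfShape J (lfcEv.{w} C ⋙
        (leftExactFunctor (LFCFunctor.{w} C (Type w)) (Type w)).ι) :=
      preservesColimitsOfShape_of_evaluation _ _
        fun X => X.property.2.preserves_filtered_colimits J
    preservesColimitsOfShape_lift _ _ _⟩⟩

end Precomposition

section FinitelyPresentable

variable (A : Type u₁) [Category.{w} A]

/-- The full subcategory `A_fp` of finitely presentable objects. -/
abbrev FP := (ObjectProperty.isFinitelyPresentable.{w} A).FullSubcategory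

/-- The functor `A_fpᵒᵖ ⥤ LFC(A, Set)`, `X ↦ A(X, -)`. -/
def fpCoyoneda : (FP A)ᵒᵖ ⥤ LFCFunctor.{w} A (Type w) :=
  ObjectProperty.lift _ ((ObjectProperty.isFinitelyPresentable.{w} A).ι.op ⋙ coyoneda)
    fun X => ⟨inferInstanceAs (PreservesLimitsOfSize.{w, w} (coyoneda.obj (op X.unop.obj))),
      isFinitelyPresentable_iff_preservesFilteredColimitsOfSize.1 X.unop.property⟩

instance fp_closedUnderFiniteColimits (J : Type) [SmallCategory J] [FinCategory J] :
    (ObjectProperty.isFinitelyPresentable.{w} A).IsClosedUnderColimitsOfShape J := by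
  have := Cardinal.fact_isRegular_aleph0.{w}
  rw [ObjectProperty.isFinitelyPresentable_eq_isCardinalPresentable]
  exact isClosedUnderColimitsOfShape_isCardinalPresentable A
    (κ := Cardinal.aleph0.{w}) ((hasCardinalLT_aleph0_iff _).2 inferInstance)

/-- The functor `A ⥤ LEX(A_fpᵒᵖ, Set)`, `a ↦ A(-, a)`. -/
def fpRestrictedYoneda [IsLocallyFinitelyPresentable.{w} A] : A ⥤ ((FP A)ᵒᵖ ⥤ₗ Type w) :=
  ObjectProperty.lift _ (yoneda ⋙ (Functor.whiskeringLeft _ _ _).obj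
      (ObjectProperty.isFinitelyPresentable.{w} A).ι.op)
    fun a => by
      have : HasFiniteColimits A := hasFiniteColimits_of_hasColimitsOfSize.{w, w} A
      have : PreservesFiniteColimits (ObjectProperty.isFinitelyPresentable.{w} A).ι :=
        ⟨fun _ _ _ => inferInstance⟩
      have : PreservesFiniteLimits (ObjectProperty.isFinitelyPresentable.{w} A).ι.op :=
        preservesFiniteLimits_op _
      exact comp_preservesFiniteLimits (ObjectProperty.isFinitelyPresentable.{w} A).ι.op
        (yoneda.obj a)

end FinitelyPresentable

section TwoCategories

/-- The objects of the 2-category `LEX` of (possibly large) finitely complete categories. Here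
`Set = Type w`; objects and morphisms of the categories are allowed to form types in `Type (w + 1)`,
so that `LEX(C, Set)` and `LFC(A, Set)` never leave the framework. The 1-cells are the functors
preserving finite limits, the 2-cells are all natural transformations. -/
structure LEX : Type (w + 2) where
  /-- The underlying category. -/
  carrier : Type (w + 1)
  [category : Category.{w + 1} carrier]
  [hasFiniteLimits : HasFiniteLimits carrier]

attribute [instance] LEX.category LEX.hasFiniteLimits

/-- The objects of the 2-category `LFC` of (possibly large) categories with `w`-small limits and
`w`-small filtered colimits. The 1-cells are the functors preserving both, the 2-cells are all
natural transformations. -/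
structure LFC : Type (w + 2) where
  /-- The underlying category. -/
  carrier : Type (w + 1)
  [category : Category.{w + 1} carrier]
  [hasLimits : HasLimitsOfSize.{w, w} carrier]
  [hasFilteredColimits : HasFilteredColimitsOfSize.{w, w} carrier]

attribute [instance] LFC.category LFC.hasLimits LFC.hasFilteredColimits

instance : CategoryStruct LEX.{w} where
  Hom C D := C.carrier ⥤ₗ D.carrier
  id C := ⟨𝟭 C.carrier, inferInstanceAs (PreservesFiniteLimits (𝟭 C.carrier))⟩
  comp F G := ⟨F.obj ⋙ G.obj, comp_preservesFiniteLimits _ _⟩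

instance (C D : LEX.{w}) : Category (C ⟶ D) :=
  inferInstanceAs (Category (C.carrier ⥤ₗ D.carrier))

namespace LEX

variable {C D E : LEX.{w}}

@[simp] lemma id_obj : (𝟙 C : C ⟶ C).obj = 𝟭 C.carrier := rfl

@[simp] lemma comp_obj (F : C ⟶ D) (G : D ⟶ E) : (F ≫ G).obj = F.obj ⋙ G.obj := rfl

@[simp] lemma id_hom (F : C ⟶ D) : (𝟙 F : F ⟶ F).hom = 𝟙 F.obj := rfl

@[simp] lemma comp_hom {F G H : C ⟶ D} (α : F ⟶ G) (β : G ⟶ H) :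
    (α ≫ β).hom = α.hom ≫ β.hom := rfl

@[ext] lemma hom₂_ext {F G : C ⟶ D} {α β : F ⟶ G}
    (h : ∀ X, α.hom.app X = β.hom.app X) : α = β :=
  ObjectProperty.hom_ext _ (NatTrans.ext (funext h))

/-- The 2-cell given by a natural transformation. -/
def mkHom₂ {F G : C ⟶ D} (α : F.obj ⟶ G.obj) : F ⟶ G := ObjectProperty.homMk α

@[simp] lemma mkHom₂_hom {F G : C ⟶ D} (α : F.obj ⟶ G.obj) : (mkHom₂ α).hom = α := rfl

/-- The invertible 2-cell given by a natural isomorphism. -/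
@[simps] def mkIso {F G : C ⟶ D} (e : F.obj ≅ G.obj) : F ≅ G where
  hom := mkHom₂ e.hom
  inv := mkHom₂ e.inv

end LEX

instance : Bicategory LEX.{w} where
  homCategory C D := inferInstance
  whiskerLeft F _ _ α := LEX.mkHom₂ (Functor.whiskerLeft F.obj α.hom)
  whiskerRight α G := LEX.mkHom₂ (Functor.whiskerRight α.hom G.obj)
  associator F G H := LEX.mkIso (F := (F ≫ G) ≫ H) (G := F ≫ G ≫ H) (Functor.associator F.obj G.obj H.obj)
  leftUnitor {C _} F := LEX.mkIso (F := 𝟙 C ≫ F) (G := F) F.obj.leftUnitor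
  rightUnitor {_ D} F := LEX.mkIso (F := F ≫ 𝟙 D) (G := F) F.obj.rightUnitor

instance : Bicategory.Strict LEX.{w} where
  id_comp _ := rfl
  comp_id _ := rfl
  assoc _ _ _ := rfl
  leftUnitor_eqToIso _ := by ext; rfl
  rightUnitor_eqToIso _ := by ext; rfl
  associator_eqToIso _ _ _ := by ext; rfl

instance : CategoryStruct LFC.{w} where
  Hom C D := LFCFunctor.{w} C.carrier D.carrier
  id C := ⟨𝟭 C.carrier, inferInstance, inferInstance⟩
  comp F G := ⟨F.obj ⋙ G.obj, lfcFunctor_comp F.property G.property⟩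

instance (C D : LFC.{w}) : Category (C ⟶ D) :=
  inferInstanceAs (Category (LFCFunctor.{w} C.carrier D.carrier))

namespace LFC

variable {C D E : LFC.{w}}

@[simp] lemma id_obj : (𝟙 C : C ⟶ C).obj = 𝟭 C.carrier := rfl

@[simp] lemma comp_obj (F : C ⟶ D) (G : D ⟶ E) : (F ≫ G).obj = F.obj ⋙ G.obj := rfl

@[simp] lemma id_hom (F : C ⟶ D) : (𝟙 F : F ⟶ F).hom = 𝟙 F.obj := rfl

@[simp] lemma comp_hom {F G H : C ⟶ D} (α : F ⟶ G) (β : G ⟶ H) :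
    (α ≫ β).hom = α.hom ≫ β.hom := rfl

@[ext] lemma hom₂_ext {F G : C ⟶ D} {α β : F ⟶ G}
    (h : ∀ X, α.hom.app X = β.hom.app X) : α = β :=
  ObjectProperty.hom_ext _ (NatTrans.ext (funext h))

/-- The 2-cell given by a natural transformation. -/
def mkHom₂ {F G : C ⟶ D} (α : F.obj ⟶ G.obj) : F ⟶ G := ObjectProperty.homMk α

@[simp] lemma mkHom₂_hom {F G : C ⟶ D} (α : F.obj ⟶ G.obj) : (mkHom₂ α).hom = α := rfl

/-- The invertible 2-cell given by a natural isomorphism. -/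
@[simps] def mkIso {F G : C ⟶ D} (e : F.obj ≅ G.obj) : F ≅ G where
  hom := mkHom₂ e.hom
  inv := mkHom₂ e.inv

end LFC

instance : Bicategory LFC.{w} where
  homCategory C D := inferInstance
  whiskerLeft F _ _ α := LFC.mkHom₂ (Functor.whiskerLeft F.obj α.hom)
  whiskerRight α G := LFC.mkHom₂ (Functor.whiskerRight α.hom G.obj)
  associator F G H := LFC.mkIso (F := (F ≫ G) ≫ H) (G := F ≫ G ≫ H) (Functor.associator F.obj G.obj H.obj)
  leftUnitor {C _} F := LFC.mkIso (F := 𝟙 C ≫ F) (G := F) F.obj.leftUnitor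
  rightUnitor {_ D} F := LFC.mkIso (F := F ≫ 𝟙 D) (G := F) F.obj.rightUnitor

instance : Bicategory.Strict LFC.{w} where
  id_comp _ := rfl
  comp_id _ := rfl
  assoc _ _ _ := rfl
  leftUnitor_eqToIso _ := by ext; rfl
  rightUnitor_eqToIso _ := by ext; rfl
  associator_eqToIso _ _ _ := by ext; rfl


end TwoCategories

section TwoAdjunctions

variable {B : Type u₁} [Bicategory.{w₁, v₁} B] {C : Type u₂} [Bicategory.{w₂, v₂} C]

/-- A (strict) 2-natural transformation between 2-functors. -/
structure TwoNatTrans (F G : StrictPseudofunctor B C) where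
  /-- The components. -/
  app (b : B) : F.obj b ⟶ G.obj b
  /-- Naturality with respect to 1-cells. -/
  naturality {a b : B} (f : a ⟶ b) : F.map f ≫ app b = app a ≫ G.map f
  /-- Naturality with respect to 2-cells. -/
  naturality₂ {a b : B} {f g : a ⟶ b} (α : f ⟶ g) :
    F.map₂ α ▷ app b ≫ eqToHom (naturality g) = eqToHom (naturality f) ≫ app a ◁ G.map₂ α

/-- A (strict) 2-adjunction `L ⊣ R`: 2-natural unit and counit satisfying the triangle
identities. -/
structure TwoAdjunction (L : StrictPseudofunctor B C) (R : StrictPseudofunctor C B) where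
  /-- The unit. -/
  unit : TwoNatTrans (StrictPseudofunctor.id B) (L.comp R)
  /-- The counit. -/
  counit : TwoNatTrans (R.comp L) (StrictPseudofunctor.id C)
  left_triangle (b : B) : L.map (unit.app b) ≫ counit.app (L.obj b) = 𝟙 (L.obj b)
  right_triangle (c : C) : unit.app (R.obj c) ≫ R.map (counit.app c) = 𝟙 (R.obj c)

/-- A 1-cell of a 2-category is an equivalence if it has an inverse up to invertible 2-cells. -/
def IsEquivalenceCell {a b : B} (f : a ⟶ b) : Prop := ∃ e : Bicategory.Equivalence a b, e.hom = f

/-- A 2-adjunction is an equivalence of 2-categories if all the components of its unit and of its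
counit are equivalences. -/
def TwoAdjunction.IsEquivalence {L : StrictPseudofunctor B C} {R : StrictPseudofunctor C B}
    (adj : TwoAdjunction L R) : Prop :=
  (∀ b, IsEquivalenceCell (adj.unit.app b)) ∧ ∀ c, IsEquivalenceCell (adj.counit.app c)

/-- The full sub-2-category on the objects satisfying `p`. -/
abbrev FullSub (p : B → Prop) := InducedBicategory B (Subtype.val : {b // p b} → B)

lemma fullSub_hom_sandwich {p : B → Prop} {X Y : FullSub p} {f f' g g' : X ⟶ Y} (h : f = f')
    (α : f' ⟶ g') (h' : g' = g) :
    InducedBicategory.Hom₂.hom (eqToHom h ≫ α ≫ eqToHom h') =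
      eqToHom (congrArg InducedBicategory.Hom.hom h) ≫ InducedBicategory.Hom₂.hom α ≫
        eqToHom (congrArg InducedBicategory.Hom.hom h') := by
  subst h h'
  simp only [eqToHom_refl, Category.id_comp, Category.comp_id]

lemma fullSub_hom_eqToHom_comp {p : B → Prop} {X Y : FullSub p} {f f' g : X ⟶ Y} (h : f = f')
    (α : f' ⟶ g) :
    InducedBicategory.Hom₂.hom (eqToHom h ≫ α) =
      eqToHom (congrArg InducedBicategory.Hom.hom h) ≫ InducedBicategory.Hom₂.hom α := by
  subst h
  simp only [eqToHom_refl, Category.id_comp]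

lemma fullSub_hom_comp_eqToHom {p : B → Prop} {X Y : FullSub p} {f g g' : X ⟶ Y}
    (α : f ⟶ g) (h : g = g') :
    InducedBicategory.Hom₂.hom (α ≫ eqToHom h) =
      InducedBicategory.Hom₂.hom α ≫ eqToHom (congrArg InducedBicategory.Hom.hom h) := by
  subst h
  simp only [eqToHom_refl, Category.comp_id]

variable [Strict B] [Strict C]

/-- The restriction of a 2-functor to full sub-2-categories. -/
def restrictFunctor (F : StrictPseudofunctor B C) {p : B → Prop} {q : C → Prop}
    (h : ∀ b, p b → q (F.obj b)) : StrictPseudofunctor (FullSub p) (FullSub q) :=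
  StrictPseudofunctor.mk''
    { obj b := ⟨F.obj b.1, h _ b.2⟩
      map f := InducedBicategory.mkHom (F.map f.hom)
      map₂ α := InducedBicategory.mkHom₂ (F.map₂ α.hom)
      map₂_id f := by ext; exact F.map₂_id f.hom
      map₂_comp α β := by ext; exact F.map₂_comp α.hom β.hom
      map_id b := by ext; exact F.map_id b.1
      map_comp f g := by ext; exact F.map_comp f.hom g.hom
      map₂_whisker_left f _ _ α := by
        ext
        have h := F.map₂_whisker_left f.hom α.hom
        rw [F.mapComp_eq_eqToIso, F.mapComp_eq_eqToIso] at h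
        refine Eq.trans ?_ (fullSub_hom_sandwich _ _ _).symm
        exact h
      map₂_whisker_right α f := by
        ext
        have h := F.map₂_whisker_right α.hom f.hom
        rw [F.mapComp_eq_eqToIso, F.mapComp_eq_eqToIso] at h
        refine Eq.trans ?_ (fullSub_hom_sandwich _ _ _).symm
        exact h }

/-- The restriction of a 2-adjunction to full sub-2-categories. -/
def TwoAdjunction.restrict {L : StrictPseudofunctor B C} {R : StrictPseudofunctor C B}
    (adj : TwoAdjunction L R) {p : B → Prop} {q : C → Prop}
    (hL : ∀ b, p b → q (L.obj b)) (hR : ∀ c, q c → p (R.obj c)) :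
    TwoAdjunction (restrictFunctor L hL) (restrictFunctor R hR) where
  unit :=
    { app b := InducedBicategory.mkHom (adj.unit.app b.1)
      naturality f := by ext; exact adj.unit.naturality f.hom
      naturality₂ α := by
        ext
        rw [fullSub_hom_comp_eqToHom, fullSub_hom_eqToHom_comp]
        exact adj.unit.naturality₂ α.hom }
  counit :=
    { app b := InducedBicategory.mkHom (adj.counit.app b.1)
      naturality f := by ext; exact adj.counit.naturality f.hom
      naturality₂ α := by
        ext
        rw [fullSub_hom_comp_eqToHom, fullSub_hom_eqToHom_comp]
        exact adj.counit.naturality₂ α.hom }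
  left_triangle b := by ext; exact adj.left_triangle b.1
  right_triangle c := by ext; exact adj.right_triangle c.1

end TwoAdjunctions

section Duality

instance : Bicategory.Strict LEX.{w}ᵒᵖ where
  id_comp _ := rfl
  comp_id _ := rfl
  assoc _ _ _ := rfl
  leftUnitor_eqToIso _ := rfl
  rightUnitor_eqToIso _ := rfl
  associator_eqToIso _ _ _ := rfl

/-- The 2-functor `G = LEX(-, Set) : LEXᵒᵖ ⥤ LFC`. -/
def G : StrictPseudofunctor LEX.{w}ᵒᵖ LFC.{w} :=
  StrictPseudofunctor.mk''
    { obj C := ⟨C.unop.carrier ⥤ₗ Type w⟩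
      map φ := lexPrecomp φ.unop
      map₂ α := LFC.mkHom₂
        { app M := ObjectProperty.homMk (Functor.whiskerRight α.unop2.hom M.obj)
          naturality M N f := by
            apply ObjectProperty.hom_ext
            ext X : 2
            exact (f.hom.naturality _).symm }
      map₂_id φ := by
        apply LFC.hom₂_ext
        intro M
        apply ObjectProperty.hom_ext
        ext X : 2
        exact M.obj.map_id _
      map₂_comp α β := by
        apply LFC.hom₂_ext
        intro M
        apply ObjectProperty.hom_ext
        ext X : 2
        exact M.obj.map_comp _ _
      map_id _ := rfl
      map_comp _ _ := rfl
      map₂_whisker_left _ _ _ _ := by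
        rfl
      map₂_whisker_right _ _ := rfl }

/-- The 2-functor `F = LFC(-, Set) : LFC ⥤ LEXᵒᵖ`. -/
def F : StrictPseudofunctor LFC.{w} LEX.{w}ᵒᵖ :=
  StrictPseudofunctor.mk''
    { obj A := op ⟨LFCFunctor.{w} A.carrier (Type w)⟩
      map φ := Quiver.Hom.op (V := LEX.{w}) (lfcPrecomp φ)
      map₂ α := Bicategory.Opposite.op2 (LEX.mkHom₂
        { app M := ObjectProperty.homMk (Functor.whiskerRight α.hom M.obj)
          naturality M N f := by
            apply ObjectProperty.hom_ext
            ext X : 2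
            exact (f.hom.naturality _).symm })
      map₂_id φ := by
        apply congrArg Bicategory.Opposite.op2
        apply LEX.hom₂_ext
        intro M
        apply ObjectProperty.hom_ext
        ext X : 2
        exact M.obj.map_id _
      map₂_comp α β := by
        apply congrArg Bicategory.Opposite.op2
        apply LEX.hom₂_ext
        intro M
        apply ObjectProperty.hom_ext
        ext X : 2
        exact M.obj.map_comp _ _
      map_id _ := rfl
      map_comp _ _ := rfl
      map₂_whisker_left _ _ _ _ := rfl
      map₂_whisker_right _ _ := rfl }

/-- The 2-adjunction `F ⊣ G` between `LFC` and `LEXᵒᵖ`; unit and counit are given by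
evaluation. -/
def adjunction : TwoAdjunction F.{w} G.{w} where
  unit :=
    { app A := ⟨lfcEv A.carrier, lfcEv_lfc⟩
      naturality _ := rfl
      naturality₂ _ := rfl }
  counit :=
    { app C := Quiver.Hom.op (V := LEX.{w}) ⟨lexEv C.unop.carrier, lexEv_leftExact⟩
      naturality _ := rfl
      naturality₂ _ := rfl }
  left_triangle _ := rfl
  right_triangle _ := rfl

/-- The objects of `LEXᵒᵖ` which are essentially small categories: `FullSub IsLex` is `Lexᵒᵖ`. -/
def IsLex (C : LEX.{w}ᵒᵖ) : Prop := EssentiallySmall.{w} C.unop.carrier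

/-- The objects of `LFC` which are locally finitely presentable categories: `FullSub IsLFP` is
`LFP`. -/
def IsLFP (A : LFC.{w}) : Prop := IsLocallyFinitelyPresentable.{w} A.carrier

end Duality

end GabrielUlmer

namespace GabrielUlmer

/-! ### Invariance of the two evaluation functors under equivalence -/

section Precomposition

variable {C : Type u₁} [Category.{v₁} C] {D : Type u₂} [Category.{v₂} D]

/-! Let `A` be locally finitely presentable. Finitely presentable objects are dense, so restricted
Yoneda into `LEX(A_fpᵒᵖ, Set)` is fully faithful. A left exact presheaf on `A_fp` is a small
filtered colimit of representables; the same colimit taken in `A` maps to it, because homs out of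
finitely presentable objects commute with filtered colimits. Hence `fpRestrictedYoneda` is an
equivalence and `A` inherits limits. A functor `X` in `LFC(A, Set)` is representable by the adjoint
functor theorem's argument, the generator giving the solution set; its representing object is
finitely presentable since `X` preserves filtered colimits. So `fpCoyoneda` is an equivalence, and
`lfcEv` followed by restriction along it is `fpRestrictedYoneda`; therefore `lfcEv` is an
equivalence.

For small `C` with finite limits, the representables are finitely presentable in `LEX(C, Set)` and
generate it under filtered colimits. Finitely presentable objects are thus retracts of
representables, and these are representable because idempotents split in `C`. So `Cᵒᵖ ≃ LEX(C,
Set)_fp`; composing its dual with `fpCoyoneda` gives `lexEv`, by the Yoneda lemma. -/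

lemma lfcFunctor_of_isEquivalence (φ : C ⥤ D) [φ.IsEquivalence] : lfcFunctor.{w} C D φ :=
  ⟨inferInstance, ⟨fun _ _ _ => inferInstance⟩⟩

lemma lexPrecompFunctor_isEquivalence (φ : C ⥤ₗ D) [φ.obj.IsEquivalence] :
    (lexPrecompFunctor.{w} φ).IsEquivalence := by
  have h : ((leftExactFunctor D (Type w)).ι ⋙
      (Functor.whiskeringLeft C D (Type w)).obj φ.obj).FullyFaithful :=
    .ofFullyFaithful _
  have h' : (lexPrecompFunctor.{w} φ).FullyFaithful :=
    Functor.FullyFaithful.ofCompFaithful (G := (leftExactFunctor C (Type w)).ι) h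
  exact
    { full := h'.full
      faithful := h'.faithful
      essSurj := ⟨fun M =>
        have := M.property
        ⟨⟨φ.obj.inv ⋙ M.obj, comp_preservesFiniteLimits _ _⟩,
          ⟨ObjectProperty.isoMk _ (Functor.isoWhiskerRight φ.obj.asEquivalence.unitIso.symm M.obj)⟩⟩⟩ }

lemma lfcPrecompFunctor_isEquivalence (φ : LFCFunctor.{w} C D) [φ.obj.IsEquivalence] :
    (lfcPrecompFunctor.{w} φ).IsEquivalence := by
  have h : ((lfcFunctor.{w} D (Type w)).ι ⋙
      (Functor.whiskeringLeft C D (Type w)).obj φ.obj).FullyFaithful :=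
    .ofFullyFaithful _
  have h' : (lfcPrecompFunctor.{w} φ).FullyFaithful :=
    Functor.FullyFaithful.ofCompFaithful (G := (lfcFunctor.{w} C (Type w)).ι) h
  exact
    { full := h'.full
      faithful := h'.faithful
      essSurj := ⟨fun X =>
        ⟨⟨φ.obj.inv ⋙ X.obj, lfcFunctor_comp (lfcFunctor_of_isEquivalence _) X.property⟩,
          ⟨ObjectProperty.isoMk _ (Functor.isoWhiskerRight φ.obj.asEquivalence.unitIso.symm X.obj)⟩⟩⟩ }

/-- `lexEv` is an equivalence as soon as it is so for an equivalent category. -/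
lemma lexEv_isEquivalence_of_equivalence (e : C ≌ D) [h : (lexEv.{w} D).IsEquivalence] :
    (lexEv.{w} C).IsEquivalence := by
  let φ : C ⥤ₗ D := ⟨e.functor, inferInstanceAs (PreservesFiniteLimits e.functor)⟩
  have : φ.obj.IsEquivalence := inferInstanceAs e.functor.IsEquivalence
  have h₁ := lexPrecompFunctor_isEquivalence.{w} φ
  have : (lexPrecomp.{w} φ).obj.IsEquivalence := h₁
  have h₂ := lfcPrecompFunctor_isEquivalence.{w} (lexPrecomp.{w} φ)
  -- Evaluation is strictly natural: both composites send `c` to `M ↦ M (e c)`. Two out of three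
  -- then applies.
  have : (lexEv.{w} C ⋙ lfcPrecompFunctor.{w} (lexPrecomp.{w} φ)).IsEquivalence :=
    inferInstanceAs (e.functor ⋙ lexEv.{w} D).IsEquivalence
  exact Functor.isEquivalence_of_comp_right _ (lfcPrecompFunctor.{w} (lexPrecomp.{w} φ))

/-- `lfcEv` is an equivalence as soon as it is so for an equivalent category. -/
lemma lfcEv_isEquivalence_of_equivalence (e : C ≌ D) [h : (lfcEv.{w} D).IsEquivalence] :
    (lfcEv.{w} C).IsEquivalence := by
  let φ : LFCFunctor.{w} C D := ⟨e.functor, lfcFunctor_of_isEquivalence _⟩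
  have : φ.obj.IsEquivalence := inferInstanceAs e.functor.IsEquivalence
  have h₁ := lfcPrecompFunctor_isEquivalence.{w} φ
  have : (lfcPrecomp.{w} φ).obj.IsEquivalence := h₁
  have h₂ := lexPrecompFunctor_isEquivalence.{w} (lfcPrecomp.{w} φ)
  have : (lfcEv.{w} C ⋙ lexPrecompFunctor.{w} (lfcPrecomp.{w} φ)).IsEquivalence :=
    inferInstanceAs (e.functor ⋙ lfcEv.{w} D).IsEquivalence
  exact Functor.isEquivalence_of_comp_right _ (lexPrecompFunctor.{w} (lfcPrecomp.{w} φ))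

end Precomposition

/-! ### The equivalences attached to `A_fp`, for homs in `Type w` -/

section FinitelyPresentable

variable (A : Type u₁) [Category.{w} A] [IsLocallyFinitelyPresentable.{w} A]

lemma fpRestrictedYoneda_faithful : (fpRestrictedYoneda.{w} A).Faithful where
  map_injective {Y Z f g} h := by
    refine ((ObjectProperty.isFinitelyPresentable.{w} A).ι.denseAt Y).hom_ext' fun X p => ?_
    have : p ≫ f = p ≫ g := ConcreteCategory.congr_hom (CC := fun X => X)
      (NatTrans.congr_app (congrArg (fun t => t.hom) h) (op X)) p
    -- The leg at `p` of the canonical colimit cocone is `p` preceded by an identity.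
    change 𝟙 X.obj ≫ p ≫ f = 𝟙 X.obj ≫ p ≫ g
    rw [this]

/-- A transformation `A(-, Y) ⟶ A(-, Z)` on `A_fp` is the same as a cocone with vertex `Z` on the
canonical diagram of `Y`, whose colimit is `Y` by density. -/
lemma fpRestrictedYoneda_full : (fpRestrictedYoneda.{w} A).Full where
  map_surjective {Y Z} f := by
    let c : Cocone (CostructuredArrow.proj (ObjectProperty.isFinitelyPresentable.{w} A).ι Y ⋙
        (ObjectProperty.isFinitelyPresentable.{w} A).ι) :=
      { pt := Z
        ι :=
          { app g := f.hom.app (op g.left) g.hom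
            naturality g₁ g₂ φ := by
              have h : f.hom.app (op g₁.left) (φ.left.hom ≫ g₂.hom) =
                φ.left.hom ≫ f.hom.app (op g₂.left) g₂.hom :=
                f.hom.naturality_apply φ.left.op g₂.hom
              have hφ : φ.left.hom ≫ g₂.hom = g₁.hom := CostructuredArrow.w φ
              rw [hφ] at h
              exact h.symm.trans (Category.comp_id _).symm } }
    refine ⟨((ObjectProperty.isFinitelyPresentable.{w} A).ι.denseAt Y).desc c, ?_⟩
    apply ObjectProperty.hom_ext
    ext ⟨X⟩ (x : X.obj ⟶ Y)
    have : (𝟙 X.obj ≫ x) ≫ _ = f.hom.app (op X) x :=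
      ((ObjectProperty.isFinitelyPresentable.{w} A).ι.denseAt Y).fac c (.mk x)
    exact (congrArg (· ≫ _) (Category.id_comp x)).symm.trans this

/-- Left exactness makes the category of elements filtered, and it is essentially small because `E`
is. -/
lemma isIndObject_of_leftExact {E : Type u₁} [Category.{w} E] [HasFiniteColimits E]
    [EssentiallySmall.{w} E] (M : Eᵒᵖ ⥤ₗ Type w) : IsIndObject M.obj := by
  have := M.property
  rw [isIndObject_iff]
  refine ⟨isFiltered_costructuredArrow_yoneda_of_preservesFiniteLimits _, ?_⟩
  have : EssentiallySmall.{w} (CostructuredArrow yoneda M.obj) :=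
    (essentiallySmall_congr (CategoryOfElements.costructuredArrowYonedaEquivalence M.obj)).1
      inferInstance
  exact finallySmall_of_essentiallySmall _

instance fp_hasFiniteColimits : HasFiniteColimits (FP A) :=
  have : HasFiniteColimits A := hasFiniteColimits_of_hasColimitsOfSize.{w, w} A
  ⟨fun _ _ _ => inferInstance⟩

lemma fpRestrictedYoneda_essSurj : (fpRestrictedYoneda.{w} A).EssSurj where
  mem_essImage M := by
    obtain ⟨⟨P⟩⟩ := isIndObject_of_leftExact M
    let ι := (ObjectProperty.isFinitelyPresentable.{w} A).ι
    let D : P.I ⥤ A := P.F ⋙ ι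
    have e : (fpRestrictedYoneda.{w} A).obj (colimit D) ≅ M := by
      refine ObjectProperty.isoMk _ ?_
      let c := (yoneda ⋙ (Functor.whiskeringLeft _ _ _).obj ι.op).mapCocone (colimit.cocone D)
      have hc : IsColimit c := evaluationJointlyReflectsColimits _ fun X => by
        -- Finite presentability of `X` lets `A(X, -)` commute with the colimit of `D`.
        have : PreservesFilteredColimitsOfSize.{w, w} (coyoneda.obj (op X.unop.obj)) :=
          isFinitelyPresentable_iff_preservesFilteredColimitsOfSize.1 X.unop.property
        exact isColimitOfPreserves (coyoneda.obj (op X.unop.obj)) (colimit.isColimit D)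
      let e' : P.F ⋙ yoneda ≅ D ⋙ (yoneda ⋙ (Functor.whiskeringLeft _ _ _).obj ι.op) :=
        NatIso.ofComponents fun i => NatIso.ofComponents fun X =>
          Equiv.toIso (ObjectProperty.isFinitelyPresentable.{w} A).fullyFaithfulι.homEquiv
      exact (IsColimit.coconePointsIsoOfNatIso P.isColimit hc e').symm
    exact ⟨_, ⟨e⟩⟩

lemma fpRestrictedYoneda_isEquivalence : (fpRestrictedYoneda.{w} A).IsEquivalence where
  faithful := fpRestrictedYoneda_faithful A
  full := fpRestrictedYoneda_full A
  essSurj := fpRestrictedYoneda_essSurj A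

lemma hasLimits_of_isLocallyFinitelyPresentable : HasLimitsOfSize.{w, w} A :=
  have := fpRestrictedYoneda_isEquivalence A
  Adjunction.has_limits_of_equivalence (fpRestrictedYoneda.{w} A)

/-- Freyd's argument: the category of elements is complete because `X` preserves limits, and the
elements over a small generator are weakly initial because `X` preserves filtered colimits. -/
lemma hasInitial_elements_of_lfc (X : LFCFunctor.{w} A (Type w)) : HasInitial X.obj.Elements := by
  have := hasLimits_of_isLocallyFinitelyPresentable A
  have := X.property.1
  have := X.property.2
  have := Cardinal.fact_isRegular_aleph0.{w}
  obtain ⟨Q, _, hQ⟩ := HasCardinalFilteredGenerator.exists_small_generator A Cardinal.aleph0.{w}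
  let T := Shrink.{w} (Subtype Q)
  let B : (Σ t : T, X.obj.obj ((equivShrink _).symm t).1) → X.obj.Elements :=
    fun t => X.obj.elementsMk _ t.2
  have hB (E : X.obj.Elements) : ∃ t, Nonempty (B t ⟶ E) := by
    obtain ⟨J, _, hJ, ⟨p⟩⟩ := hQ.exists_colimitsOfShape E.1
    rw [isCardinalFiltered_aleph0_iff] at hJ
    obtain ⟨j, y, hy⟩ :=
      Types.jointly_surjective_of_isColimit (isColimitOfPreserves X.obj p.isColimit) E.2
    obtain ⟨q, hq⟩ := (equivShrink (Subtype Q)).symm.surjective ⟨_, p.prop_diag_obj j⟩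
    -- The element `y` lies over a diagram object, while `B` is indexed by the shrunken generator; a
    -- variable `s` allows their equality to be substituted in the type of `z`.
    have key (s : Subtype Q) (hs : s = ⟨_, p.prop_diag_obj j⟩) :
        ∃ z, Nonempty (X.obj.elementsMk s.1 z ⟶ E) := by
      subst hs
      exact ⟨y, ⟨CategoryOfElements.homMk _ _ (p.ι.app j) hy⟩⟩
    obtain ⟨z, hz⟩ := key _ hq
    exact ⟨⟨q, z⟩, hz⟩
  obtain ⟨E, hE⟩ := has_weakly_initial_of_weakly_initial_set_and_hasProducts hB
  -- The initial object is the wide equalizer of all endomorphisms of `E`; these form a type in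
  -- `Type w` because the homs of `A` do.
  exact hasInitial_of_weakly_initial_and_hasWideEqualizers hE

lemma fpCoyoneda_essSurj : (fpCoyoneda.{w} A).EssSurj where
  mem_essImage X := by
    have := hasInitial_elements_of_lfc A X
    have := Functor.Elements.isCorepresentable_of_hasInitial X.obj
    let e := X.obj.corepresentableBy.toIso
    refine ⟨op ⟨X.obj.coreprX, ?_⟩, ⟨ObjectProperty.isoMk _ e⟩⟩
    refine isFinitelyPresentable_iff_preservesFilteredColimitsOfSize.2 ⟨fun J _ _ => ?_⟩
    have := X.property.2.preserves_filtered_colimits J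
    exact preservesColimitsOfShape_of_natIso e.symm

lemma fpCoyoneda_isEquivalence : (fpCoyoneda.{w} A).IsEquivalence where
  faithful :=
    Functor.Faithful.of_comp_eq (G := (lfcFunctor.{w} A (Type w)).ι)
      (H := (ObjectProperty.isFinitelyPresentable.{w} A).ι.op ⋙ coyoneda) rfl
  full :=
    Functor.Full.of_comp_faithful_iso (G := (lfcFunctor.{w} A (Type w)).ι)
      (H := (ObjectProperty.isFinitelyPresentable.{w} A).ι.op ⋙ coyoneda) (Iso.refl _)
  essSurj := fpCoyoneda_essSurj A

end FinitelyPresentable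

/-! ### The unit, for homs in `Type w` -/

section LocallyFinitelyPresentable

variable (A : Type u₁) [Category.{w} A] [IsLocallyFinitelyPresentable.{w} A]

lemma lfcEv_isEquivalence_of_locallySmall : (lfcEv.{w} A).IsEquivalence := by
  have h := fpCoyoneda_isEquivalence A
  let φ : (FP A)ᵒᵖ ⥤ₗ LFCFunctor.{w} A (Type w) :=
    ⟨fpCoyoneda.{w} A, inferInstanceAs (PreservesFiniteLimits (fpCoyoneda.{w} A))⟩
  have : φ.obj.IsEquivalence := h
  have := lexPrecompFunctor_isEquivalence.{w} φ
  -- Evaluating `A(X, -)` at `a` gives `A(X, a)`, so this composite is `fpRestrictedYoneda` by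
  -- definition.
  have : (lfcEv.{w} A ⋙ lexPrecompFunctor.{w} φ).IsEquivalence :=
    fpRestrictedYoneda_isEquivalence A
  exact Functor.isEquivalence_of_comp_right _ (lexPrecompFunctor.{w} φ)

lemma lfcFunctor_essentiallySmall_of_locallySmall :
    EssentiallySmall.{w} (LFCFunctor.{w} A (Type w)) :=
  have := fpCoyoneda_isEquivalence A
  (essentiallySmall_congr (fpCoyoneda.{w} A).asEquivalence).1 inferInstance

end LocallyFinitelyPresentable

/-! ### Transfer to arbitrary hom universes -/

section

variable (A : Type u₁) [Category.{v₁} A] [IsLocallyFinitelyPresentable.{w} A]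

lemma isLocallyFinitelyPresentable_shrinkHoms :
    IsLocallyFinitelyPresentable.{w} (ShrinkHoms.{u₁} A) :=
  have := Cardinal.fact_isRegular_aleph0.{w}
  (ShrinkHoms.equivalence.{w} A).isCardinalLocallyPresentable Cardinal.aleph0.{w}

lemma hasLimitsOfSize_of_isLocallyFinitelyPresentable : HasLimitsOfSize.{w, w} A :=
  have := isLocallyFinitelyPresentable_shrinkHoms.{w} A
  have := hasLimits_of_isLocallyFinitelyPresentable (ShrinkHoms.{u₁} A)
  Adjunction.has_limits_of_equivalence (ShrinkHoms.functor.{w} A)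

lemma lfcEv_isEquivalence : (lfcEv.{w} A).IsEquivalence :=
  have := isLocallyFinitelyPresentable_shrinkHoms.{w} A
  have := lfcEv_isEquivalence_of_locallySmall (ShrinkHoms.{u₁} A)
  lfcEv_isEquivalence_of_equivalence (ShrinkHoms.equivalence.{w} A)

lemma lfcFunctor_essentiallySmall : EssentiallySmall.{w} (LFCFunctor.{w} A (Type w)) := by
  have := isLocallyFinitelyPresentable_shrinkHoms.{w} A
  let φ : LFCFunctor.{w} A (ShrinkHoms.{u₁} A) :=
    ⟨ShrinkHoms.functor.{w} A, lfcFunctor_of_isEquivalence _⟩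
  have : φ.obj.IsEquivalence := inferInstanceAs (ShrinkHoms.functor.{w} A).IsEquivalence
  have := lfcPrecompFunctor_isEquivalence.{w} φ
  exact (essentiallySmall_congr (lfcPrecompFunctor.{w} φ).asEquivalence).1
    (lfcFunctor_essentiallySmall_of_locallySmall (ShrinkHoms.{u₁} A))

end

/-! ### Left exact functors on a small category, and the counit -/

section LeftExact

variable (C : Type w) [SmallCategory C] [HasFiniteLimits C]

/-- The functor `Cᵒᵖ ⥤ LEX(C, Set)`, `c ↦ C(c, -)`, in the form `c ↦ Cᵒᵖ(-, c)`. -/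
def lexYoneda : Cᵒᵖ ⥤ (C ⥤ₗ Type w) :=
  ObjectProperty.lift _ (yoneda ⋙ (Functor.whiskeringLeft _ _ _).obj (opOp C))
    fun c => comp_preservesFiniteLimits (opOp C) (yoneda.obj c)

/-- The Yoneda lemma for `lexYoneda`. -/
def lexYonedaEquiv {c : C} {M : C ⥤ₗ Type w} :
    ((lexYoneda C).obj (op c) ⟶ M) ≃ M.obj.obj c where
  toFun f := f.hom.app c (𝟙 (op c))
  invFun x := ObjectProperty.homMk
    { app _ := ↾fun g => M.obj.map g.unop x
      naturality d d' f := by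
        ext g
        exact ConcreteCategory.congr_hom (CC := fun X => X) (M.obj.map_comp g.unop f) x }
  left_inv f := by
    apply ObjectProperty.hom_ext
    ext d (g : op d ⟶ op c)
    refine (f.hom.naturality_apply g.unop (𝟙 (op c))).symm.trans ?_
    exact congrArg (f.hom.app d) (Category.comp_id g)
  right_inv x := by
    exact ConcreteCategory.congr_hom (CC := fun X => X) (M.obj.map_id c) x

instance : (lexYoneda C).Full :=
  Functor.Full.of_comp_faithful_iso (G := (leftExactFunctor C (Type w)).ι)
    (H := yoneda ⋙ (Functor.whiskeringLeft _ _ _).obj (opOp C)) (Iso.refl _)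

instance : (lexYoneda C).Faithful :=
  Functor.Faithful.of_comp_eq (G := (leftExactFunctor C (Type w)).ι)
    (H := yoneda ⋙ (Functor.whiskeringLeft _ _ _).obj (opOp C)) rfl

/-- The Yoneda lemma, natural in both variables. -/
def lexYonedaIso (c : C) :
    coyoneda.obj (op ((lexYoneda C).obj (op c))) ≅ (lexEvaluation.{w} C c).obj :=
  NatIso.ofComponents fun M => (lexYonedaEquiv C).toIso

/-- By Yoneda, homs out of a representable are evaluation, which preserves filtered colimits. -/
instance (c : Cᵒᵖ) : IsFinitelyPresentable.{w} ((lexYoneda C).obj c) :=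
  isFinitelyPresentable_iff_preservesFilteredColimitsOfSize.2 ⟨fun J _ _ =>
    have := (lexEvaluation.{w} C c.unop).property.2.preserves_filtered_colimits J
    preservesColimitsOfShape_of_natIso (lexYonedaIso C c.unop).symm⟩

attribute [local instance] Cardinal.fact_isRegular_aleph0

lemma lexYoneda_isCardinalFilteredGenerator :
    (ObjectProperty.ofObj (lexYoneda C).obj).IsCardinalFilteredGenerator Cardinal.aleph0.{w} where
  le_isCardinalPresentable := by
    rintro _ ⟨c⟩
    exact inferInstanceAs (IsFinitelyPresentable.{w} ((lexYoneda C).obj c))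
  exists_colimitsOfShape M := by
    -- Viewed as a presheaf on `Cᵒᵖ`, `M` is an ind-object; whiskering with `opOp C` carries its
    -- presentation back to functors on `C`.
    let M' : Cᵒᵖᵒᵖ ⥤ₗ Type w := ⟨unopUnop C ⋙ M.obj,
      have := M.property
      comp_preservesFiniteLimits _ _⟩
    obtain ⟨⟨P⟩⟩ := isIndObject_of_leftExact M'
    refine ⟨P.I, inferInstance, ?_, ⟨?_⟩⟩
    · rw [isCardinalFiltered_aleph0_iff]
      infer_instance
    let c : Cocone (P.F ⋙ lexYoneda C) :=
      { pt := M
        ι :=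
          { app i := ObjectProperty.homMk (Functor.whiskerLeft (opOp C) (P.ι.app i))
            naturality i j f := by
              apply ObjectProperty.hom_ext
              exact congrArg (Functor.whiskerLeft (opOp C)) (P.ι.naturality f) } }
    have hc : IsColimit c := isColimitOfReflects (leftExactFunctor C (Type w)).ι
      (isColimitOfPreserves ((Functor.whiskeringLeft _ _ (Type w)).obj (opOp C)) P.isColimit)
    exact
      { diag := P.F ⋙ lexYoneda C
        ι := c.ι
        isColimit := hc
        prop_diag_obj i := ⟨_⟩ }

/-- Up to the double opposite this is `Ind Cᵒᵖ`, which is cocomplete because `Cᵒᵖ` has finite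
colimits. -/
lemma leftExact_hasColimits : HasColimitsOfSize.{w, w} (C ⥤ₗ Type w) := by
  let φ : C ⥤ₗ Cᵒᵖᵒᵖ := ⟨opOp C, inferInstanceAs (PreservesFiniteLimits (opOp C))⟩
  have : φ.obj.IsEquivalence := inferInstanceAs (opOp C).IsEquivalence
  have := lexPrecompFunctor_isEquivalence.{w} φ
  have : HasColimitsOfSize.{w, w} (Cᵒᵖᵒᵖ ⥤ₗ Type w) :=
    Adjunction.has_colimits_of_equivalence (Ind.leftExactFunctorEquivalence Cᵒᵖ).inverse
  exact Adjunction.has_colimits_of_equivalence (lexPrecompFunctor.{w} φ).inv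

lemma isLocallyFinitelyPresentable_leftExact_of_small :
    IsLocallyFinitelyPresentable.{w} (C ⥤ₗ Type w) :=
  have := leftExact_hasColimits C
  have := (lexYoneda_isCardinalFilteredGenerator C).hasCardinalFilteredGenerator
  { }

/-- The corestriction of `lexYoneda` to finitely presentable objects. -/
def lexYonedaFP : Cᵒᵖ ⥤ FP (C ⥤ₗ Type w) :=
  ObjectProperty.lift _ (lexYoneda C) fun c =>
    inferInstanceAs (IsFinitelyPresentable.{w} ((lexYoneda C).obj c))

/-- The idempotent on `H.obj Y` defined by the retract lifts to `Y` and splits there; splittings are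
unique up to isomorphism. -/
lemma mem_essImage_of_retract {D : Type u₁} [Category.{v₁} D] {E : Type u₂} [Category.{v₂} E]
    [IsIdempotentComplete D] (H : D ⥤ E) [H.Full] [H.Faithful] {X : E} {Y : D}
    (r : Retract X (H.obj Y)) : H.essImage X := by
  obtain ⟨p, hp⟩ := H.map_surjective (r.r ≫ r.i)
  obtain ⟨Z, i, e, hie, hei⟩ := IsIdempotentComplete.idempotents_split Y p
    (H.map_injective (by simp [hp]))
  have h₁ : H.map i ≫ H.map e = 𝟙 _ := by rw [← H.map_comp, hie, H.map_id]
  have h₂ : H.map e ≫ H.map i = r.r ≫ r.i := by rw [← H.map_comp, hei, hp]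
  refine ⟨Z, ⟨⟨H.map i ≫ r.r, r.i ≫ H.map e, ?_, ?_⟩⟩⟩
  · rw [Category.assoc, ← reassoc_of% h₂, h₁, Category.comp_id, h₁]
  · rw [Category.assoc, reassoc_of% h₂]
    simp

lemma lexYonedaFP_isEquivalence : (lexYonedaFP C).IsEquivalence where
  full := Functor.Full.of_comp_faithful_iso (H := lexYoneda C)
    (G := (ObjectProperty.isFinitelyPresentable.{w} (C ⥤ₗ Type w)).ι) (Iso.refl _)
  faithful := Functor.Faithful.of_comp_eq (H := lexYoneda C)
    (G := (ObjectProperty.isFinitelyPresentable.{w} (C ⥤ₗ Type w)).ι) rfl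
  essSurj := ⟨fun X => by
    have : IsIdempotentComplete C :=
      (Idempotents.isIdempotentComplete_iff_hasEqualizer_of_id_and_idempotent C).2
        fun _ _ _ => inferInstance
    have hX : isCardinalPresentable _ Cardinal.aleph0.{w} X.obj := X.property
    -- Finitely presentable objects are the retracts of objects of a filtered generator, here of
    -- representables.
    rw [(lexYoneda_isCardinalFilteredGenerator C).isPresentable_eq_retractClosure] at hX
    obtain ⟨_, ⟨c⟩, ⟨r⟩⟩ := hX
    obtain ⟨d, ⟨e⟩⟩ := mem_essImage_of_retract (lexYoneda C) r
    exact ⟨d, ⟨ObjectProperty.isoMk _ e⟩⟩⟩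

lemma lexEv_isEquivalence_of_small : (lexEv.{w} C).IsEquivalence := by
  have := isLocallyFinitelyPresentable_leftExact_of_small C
  have := lexYonedaFP_isEquivalence C
  have := fpCoyoneda_isEquivalence (C ⥤ₗ Type w)
  let e : (lexYonedaFP C).rightOp ⋙ fpCoyoneda.{w} (C ⥤ₗ Type w) ≅ lexEv.{w} C :=
    NatIso.ofComponents (fun c => ObjectProperty.isoMk _ (lexYonedaIso C c)) fun {c d} f => by
      apply ObjectProperty.hom_ext
      ext M (g : (lexYoneda C).obj (op c) ⟶ M)
      -- Naturality of the Yoneda bijection in `c`: applying `M f` to the element `g (𝟙 c)` gives `g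
      -- f`.
      refine Eq.trans ?_ (g.hom.naturality_apply f (𝟙 (op c)))
      exact congrArg (g.hom.app d) ((Category.id_comp f.op).trans (Category.comp_id f.op).symm)
  exact (Functor.isEquivalence_iff_of_iso e).1 inferInstance

end LeftExact

/-! ### Transfer to essentially small categories -/

section

variable (C : Type u₁) [Category.{v₁} C] [HasFiniteLimits C] [EssentiallySmall.{w} C]

lemma hasFiniteLimits_smallModel : HasFiniteLimits (SmallModel.{w} C) :=
  ⟨fun _ _ _ => Adjunction.hasLimitsOfShape_of_equivalence (equivSmallModel.{w} C).inverse⟩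

lemma isLocallyFinitelyPresentable_leftExact :
    IsLocallyFinitelyPresentable.{w} (C ⥤ₗ Type w) := by
  have := Cardinal.fact_isRegular_aleph0.{w}
  have := hasFiniteLimits_smallModel.{w} C
  have := isLocallyFinitelyPresentable_leftExact_of_small (SmallModel.{w} C)
  let φ : C ⥤ₗ SmallModel.{w} C :=
    ⟨(equivSmallModel.{w} C).functor,
      inferInstanceAs (PreservesFiniteLimits (equivSmallModel.{w} C).functor)⟩
  have : φ.obj.IsEquivalence := inferInstanceAs (equivSmallModel.{w} C).functor.IsEquivalence
  have := lexPrecompFunctor_isEquivalence.{w} φ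
  exact (lexPrecompFunctor.{w} φ).asEquivalence.isCardinalLocallyPresentable Cardinal.aleph0.{w}

lemma lexEv_isEquivalence : (lexEv.{w} C).IsEquivalence :=
  have := hasFiniteLimits_smallModel.{w} C
  have := lexEv_isEquivalence_of_small (SmallModel.{w} C)
  lexEv_isEquivalence_of_equivalence (equivSmallModel.{w} C)

end

/-! ### From equivalences of categories to equivalence 1-cells -/

section Bicategories

variable {B : Type u₁} [Bicategory.{w₁, v₁} B]

/-- `Bicategory.Equivalence` includes a triangle identity; replacing the counit `θ` enforces it. -/
lemma isEquivalenceCell_of_iso {a b : B} {f : a ⟶ b} {g : b ⟶ a} (η : 𝟙 a ≅ f ≫ g)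
    (θ : g ≫ f ≅ 𝟙 b) : IsEquivalenceCell f :=
  ⟨Bicategory.Equivalence.mkOfAdjointifyCounit η θ, rfl⟩

/-- Only 1-cells are reversed in the opposite, so unit and counit trade places through their
inverses. -/
lemma IsEquivalenceCell.op {a b : B} {f : a ⟶ b} (h : IsEquivalenceCell f) :
    IsEquivalenceCell (Quiver.Hom.op f) := by
  obtain ⟨e, rfl⟩ := h
  exact isEquivalenceCell_of_iso (g := e.inv.op) e.counit.symm.op2 e.unit.symm.op2

lemma IsEquivalenceCell.mkHom {p : B → Prop} {X Y : FullSub p} {f : X.1 ⟶ Y.1}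
    (h : IsEquivalenceCell f) :
    IsEquivalenceCell (InducedBicategory.mkHom f : X ⟶ Y) := by
  obtain ⟨e, rfl⟩ := h
  exact isEquivalenceCell_of_iso (g := (InducedBicategory.mkHom e.inv : Y ⟶ X))
    (InducedBicategory.isoMk e.unit) (InducedBicategory.isoMk e.counit)

lemma LEX.isEquivalenceCell {C D : LEX.{w}} (f : C ⟶ D) (h : f.obj.IsEquivalence) :
    IsEquivalenceCell f :=
  isEquivalenceCell_of_iso
    (g := (⟨f.obj.inv, inferInstanceAs (PreservesFiniteLimits f.obj.inv)⟩ : D ⟶ C))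
    (LEX.mkIso f.obj.asEquivalence.unitIso) (LEX.mkIso f.obj.asEquivalence.counitIso)

lemma LFC.isEquivalenceCell {C D : LFC.{w}} (f : C ⟶ D) (h : f.obj.IsEquivalence) :
    IsEquivalenceCell f :=
  isEquivalenceCell_of_iso
    (g := (⟨f.obj.inv, lfcFunctor_of_isEquivalence _⟩ : D ⟶ C))
    (LFC.mkIso f.obj.asEquivalence.unitIso) (LFC.mkIso f.obj.asEquivalence.counitIso)

end Bicategories

end GabrielUlmer

/-! ### The duality theorem -/

theorem theorem1p1 :
    (∀ (C : Type u) [Category.{v} C] [HasFiniteLimits C] [EssentiallySmall.{w} C],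
      IsLocallyFinitelyPresentable.{w} (C ⥤ₗ Type w) ∧
      (GabrielUlmer.lexEv.{w} C).IsEquivalence) ∧
    (∀ (A : Type u) [Category.{v} A] [IsLocallyFinitelyPresentable.{w} A],
      HasLimitsOfSize.{w, w} A ∧ HasFilteredColimitsOfSize.{w, w} A ∧
      HasFiniteLimits (GabrielUlmer.LFCFunctor.{w} A (Type w)) ∧
      EssentiallySmall.{w} (GabrielUlmer.LFCFunctor.{w} A (Type w)) ∧
      (GabrielUlmer.lfcEv.{w} A).IsEquivalence) ∧
    (∀ (A : Type u) [Category.{w} A] [IsLocallyFinitelyPresentable.{w} A],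
      (GabrielUlmer.fpCoyoneda.{w} A).IsEquivalence ∧
      (GabrielUlmer.fpRestrictedYoneda.{w} A).IsEquivalence) ∧
    ∃ (hF : ∀ A, GabrielUlmer.IsLFP.{w} A → GabrielUlmer.IsLex (GabrielUlmer.F.obj A))
      (hG : ∀ C, GabrielUlmer.IsLex.{w} C → GabrielUlmer.IsLFP (GabrielUlmer.G.obj C)),
      (GabrielUlmer.adjunction.{w}.restrict hF hG).IsEquivalence := by
  refine ⟨fun C _ _ _ => ⟨GabrielUlmer.isLocallyFinitelyPresentable_leftExact C,
      GabrielUlmer.lexEv_isEquivalence C⟩,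
    fun A _ _ => ⟨GabrielUlmer.hasLimitsOfSize_of_isLocallyFinitelyPresentable A,
      ⟨fun _ _ _ => inferInstance⟩, inferInstance, GabrielUlmer.lfcFunctor_essentiallySmall A,
      GabrielUlmer.lfcEv_isEquivalence A⟩,
    fun A _ _ => ⟨GabrielUlmer.fpCoyoneda_isEquivalence A,
      GabrielUlmer.fpRestrictedYoneda_isEquivalence A⟩,
    fun A hA => ?_, fun C hC => ?_, fun A => ?_, fun C => ?_⟩
  · have : IsLocallyFinitelyPresentable.{w} A.carrier := hA
    exact GabrielUlmer.lfcFunctor_essentiallySmall A.carrier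
  · have : EssentiallySmall.{w} C.unop.carrier := hC
    exact GabrielUlmer.isLocallyFinitelyPresentable_leftExact C.unop.carrier
  · have : IsLocallyFinitelyPresentable.{w} A.1.carrier := A.2
    exact (GabrielUlmer.LFC.isEquivalenceCell (GabrielUlmer.adjunction.unit.app A.1)
      (GabrielUlmer.lfcEv_isEquivalence A.1.carrier)).mkHom
  -- The counit component is a 1-cell of `LEXᵒᵖ`, so it is treated in `LEX` and then dualised.
  · have : EssentiallySmall.{w} C.1.unop.carrier := C.2
    exact (GabrielUlmer.LEX.isEquivalenceCell (GabrielUlmer.adjunction.counit.app C.1).unop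
      (GabrielUlmer.lexEv_isEquivalence C.1.unop.carrier)).op.mkHom
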